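/- **Theorem 1.** All digraphs are finite, without loops and without parallel edges (a pair of opposite edges $(u,v),(v,u)$ is allowed). For a digraph $D$ let $\delta^0(D)$ be its minimum semidegree, i.e. the minimum of all in-degrees and out-degrees of vertices of $D$. An oriented tree is a digraph obtained from an undirected tree by giving each edge exactly one direction; the total degree of a vertex is the sum of its in-degree and its out-degree. For $p\in[0,1]$, $D(n,p)$ denotes the random digraph on $n$ labelled vertices in which each of the $n(n-1)$ ordered pairs of distinct vertices is an edge independently with probability $p$. We write $T\subseteq D$ if there is an injective map $\phi\colon V(T)\to V(D)$ with $(\phi(u),\phi(v))\in E(D)$ for every $(u,v)\in E(T)$. For all $0<\alpha<1$ and $\Delta\in\mathbb{N}$ there is a constant $c=c(\alpha,\Delta)>0$ such that for every $\varepsilon>0$ there is $N$ (depending only on $\alpha,\Delta,\varepsilon$), which may be taken to be at least $c$, such that the following holds for all $n\ge N$. If $D_\alpha$ is any $n$-vertex digraph with $\delta^0(D_\alpha)\ge\alpha n$, $T$ is any $n$-vertex oriented tree in which every vertex has total degree at most $\Delta$, and $R\sim D(n,c/n)$ is a random digraph on the vertex set of $D_\alpha$, then $$\Pr\bigl[\,T\subseteq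 D_\alpha\cup R\,\bigr]\ \ge\ 1-\varepsilon .$$ In other words, $T\subseteq D_\alpha\cup D(n,c/n)$ with probability tending to $1$ as $n\to\infty$. -/

import Mathlib

namespace Digraph

/-- The number of out-neighbours of `v`. -/
noncomputable def outDegree {V : Type*} (D : Digraph V) (v : V) : ℕ :=
  {w : V | D.Adj v w}.ncard

/-- The number of in-neighbours of `v`. -/
noncomputable def inDegree {V : Type*} (D : Digraph V) (v : V) : ℕ :=
  {w : V | D.Adj w v}.ncard

/-- The minimum of all in- and out-degrees of a (finite, nonempty) digraph. -/
noncomputable def minSemidegree {V : Type*} (D : Digraph V) : ℕ :=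
  ⨅ v : V, min (D.outDegree v) (D.inDegree v)

/-- The maximum over all vertices of a finite digraph of the in-degree plus the out-degree. -/
noncomputable def maxTotalDegree {V : Type*} (D : Digraph V) : ℕ :=
  ⨆ v : V, (D.inDegree v + D.outDegree v)

/-- No edge joins a vertex to itself (Mathlib's `Digraph` allows loops). -/
def Loopless {V : Type*} (D : Digraph V) : Prop :=
  ∀ v, ¬ D.Adj v v

/-- An oriented tree: there are no loops, there is at most one edge between any two vertices,
and the underlying undirected graph is a tree. -/
def IsOrientedTree {V : Type*} (T : Digraph V) : Prop :=
  T.Loopless ∧ (∀ v w, T.Adj v w → ¬ T.Adj w v) ∧ T.toSimpleGraphInclusive.IsTree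

/-- `H` is contained in `D`: some injective map of the vertices sends each edge of `H` to an
edge of `D` with the same direction. -/
def Contained {V W : Type*} (H : Digraph V) (D : Digraph W) : Prop :=
  ∃ φ : V → W, Function.Injective φ ∧ ∀ v w, H.Adj v w → D.Adj (φ v) (φ w)

/-- The digraph with edge set `E`. -/
def ofEdgeSet {V : Type*} (E : Set (V × V)) : Digraph V where
  Adj v w := (v, w) ∈ E

/-- The law of the edge set of the binomial random digraph on `V`: each ordered pair of distinct
vertices is an edge with probability `p`, independently of all the others. -/
noncomputable def binomialRandomEdges (V : Type*) (p : unitInterval) :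
    MeasureTheory.Measure (Set (V × V)) :=
  ProbabilityTheory.setBernoulli {e : V × V | e.1 ≠ e.2} p

/-- The edge probability `c / n`, truncated to `[0, 1]`; it equals `c / n` once `n ≥ c > 0`. -/
noncomputable def edgeProb (c : ℝ) (n : ℕ) : unitInterval :=
  Set.projIcc (0 : ℝ) 1 zero_le_one (c / n)

end Digraph

/-! The random digraph supplies an almost spanning copy of the tree, and the dense digraph `D`
completes it.

For `k = δn` and `c` large, a union bound shows that the random digraph joins every two `k`-sets in
each direction (`Joined`). Then large sets of half-edges, i.e. pairs (vertex, direction), see all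
but fewer than `k` vertices, and after deletion of a small set the small ones expand too. A
Hall-type condition on the outstanding demands of the placed vertices can therefore be maintained
while the tree is embedded vertex by vertex (`Joined.exists_embedsOn`), until only linearly few
vertices, a small multiple of `k`, are missing.

The law of the random digraph is invariant under relabelling, so this embedding may be composed with
a uniformly random permutation, independent of `D`. With high probability every triple of a
direction, a vertex `u` and a vertex `w` then has linearly many switchable `p`: the image of `p` is
a `D`-neighbour of `u`, and `w` can replace it using edges of `D` (`card_filter_switchable_lt_le`).
To attach a missing vertex `q` to its embedded neighbour `s`, take such a `p` for the image of `s`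
and the spare vertex assigned to `q`, and exchange the images of `p` and `q`. Each exchange spoils
boundedly many candidates, so all missing vertices can be added (`contained_of_switchable`). -/

open Finset

/-! ### Growing a tree one vertex at a time. -/

namespace SimpleGraph

/-- Every vertex of `S` is joined to `r` by a walk inside `S`. -/
def RootedIn {V : Type*} (G : SimpleGraph V) (r : V) (S : Finset V) : Prop :=
  ∀ a ∈ S, ∃ p : G.Walk r a, ∀ x ∈ p.support, x ∈ S

lemma rootedIn_singleton {V : Type*} (G : SimpleGraph V) (r : V) : G.RootedIn r {r} := by
  intro a ha
  obtain rfl := Finset.mem_singleton.1 ha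
  exact ⟨.nil, by simp⟩

/-- A vertex outside a connected part of an acyclic graph has at most one neighbour in it. -/
lemma IsAcyclic.eq_of_adj_rootedIn {V : Type*} {G : SimpleGraph V} (hG : G.IsAcyclic) {r : V}
    {S : Finset V} (hS : G.RootedIn r S) {a b q : V} (ha : a ∈ S) (hb : b ∈ S) (hq : q ∉ S)
    (haq : G.Adj a q) (hbq : G.Adj b q) : a = b := by
  classical
  obtain ⟨p, hp⟩ := hS a ha
  obtain ⟨p', hp'⟩ := hS b hb
  have h₁ : (p.bypass.concat haq).IsPath :=
    p.bypass_isPath.concat (fun h ↦ hq (hp _ (p.support_bypass_subset_support h))) haq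
  have h₂ : (p'.bypass.concat hbq).IsPath :=
    p'.bypass_isPath.concat (fun h ↦ hq (hp' _ (p'.support_bypass_subset_support h))) hbq
  -- Paths from `r` to `q` are unique, and these two have penultimate vertices `a` and `b`.
  have h := congrArg Subtype.val ((hG.subsingleton_path r q).elim ⟨_, h₁⟩ ⟨_, h₂⟩)
  have h' := congrArg Walk.penultimate h
  simpa using h'

/-- A connected proper part of a tree can be extended by a vertex with exactly one neighbour
in it. -/
lemma IsTree.exists_rootedIn_insert {V : Type*} [Fintype V] [DecidableEq V] {G : SimpleGraph V}
    (hG : G.IsTree) {r : V} {S : Finset V} (hr : r ∈ S) (hS : G.RootedIn r S) (hne : S ≠ univ) :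
    ∃ q ∉ S, ∃ s ∈ S, G.Adj s q ∧ (∀ a ∈ S, G.Adj a q → a = s) ∧ G.RootedIn r (insert q S) := by
  obtain ⟨v, hv⟩ : ∃ v, v ∉ S := by
    by_contra! h
    exact hne (Finset.eq_univ_iff_forall.2 h)
  obtain ⟨p⟩ := hG.connected.preconnected r v
  obtain ⟨d, -, hd₁, hd₂⟩ := p.exists_boundary_dart (S : Set V) hr hv
  refine ⟨d.snd, hd₂, d.fst, hd₁, d.adj,
    fun a ha h ↦ hG.isAcyclic.eq_of_adj_rootedIn hS ha hd₁ hd₂ h d.adj, ?_⟩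
  intro a ha
  obtain rfl | ha := Finset.mem_insert.1 ha
  · obtain ⟨p, hp⟩ := hS _ hd₁
    refine ⟨p.concat d.adj, fun x hx ↦ ?_⟩
    rw [Walk.support_concat, List.mem_append] at hx
    rcases hx with hx | hx
    · exact Finset.mem_insert_of_mem (hp x hx)
    · simp_all
  · obtain ⟨p, hp⟩ := hS a ha
    exact ⟨p, fun x hx ↦ Finset.mem_insert_of_mem (hp x hx)⟩

end SimpleGraph

/-! ### Online matching and expansion. -/

/-- One step of a greedy matching that preserves a Hall-type condition: if `r` prescribes how many
further elements of `B` each element of `A` may ask for, then a request of `a` can be answered so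
that all later requests can still be answered. -/
theorem Finset.exists_online_match {A B : Type*} [DecidableEq A] [DecidableEq B]
    (nb : A → Finset B) (A' : Finset A) (W : Finset B) (r : A → ℕ) {d m : ℕ} (hm : 1 ≤ m)
    (hr : ∀ a, r a ≤ d)
    (hsmall : ∀ X ⊆ A', #X ≤ 2 * m → ∑ x ∈ X, r x ≤ #(X.biUnion nb \ W))
    (hlarge : ∀ X ⊆ A', m ≤ #X → #X ≤ 2 * m → 2 * m * d < #(X.biUnion nb \ W))
    {a : A} (ha : a ∈ A') (hra : 0 < r a) :
    ∃ b ∈ nb a, b ∉ W ∧ ∀ X ⊆ A', #X ≤ 2 * m →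
      ∑ x ∈ X, Function.update r a (r a - 1) x ≤ #(X.biUnion nb \ insert b W) := by
  classical
  by_contra! hcon
  have hsum : ∀ X : Finset A, ∑ x ∈ X, r x ≤ #X * d := fun X ↦ by
    simpa using Finset.sum_le_card_nsmul X r d fun x _ ↦ hr x
  -- A tight set has no supply to spare. The bound `m` keeps the union of two tight sets within the
  -- range `2 * m` of `hsmall`.
  let Tight : Finset A → Prop := fun X ↦
    X ⊆ A' ∧ #X ≤ m ∧ a ∉ X ∧ #(X.biUnion nb \ W) = ∑ x ∈ X, r x
  -- Between `m` and `2 * m` the supply exceeds any possible demand, so equality forces a small set.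
  have hlt : ∀ X ⊆ A', #X ≤ 2 * m → #(X.biUnion nb \ W) = ∑ x ∈ X, r x → #X ≤ m := by
    intro X hX hc he
    by_contra! h
    have h₁ := hlarge X hX h.le hc
    have h₂ := hsum X
    have h₃ : #X * d ≤ 2 * m * d := Nat.mul_le_mul_right _ hc
    omega
  have hex : ∀ b ∈ nb a \ W, ∃ X, Tight X ∧ b ∈ X.biUnion nb := by
    intro b hb
    rw [mem_sdiff] at hb
    obtain ⟨X, hX, hXc, hlt'⟩ := hcon b hb.1 hb.2
    have hs := hsmall X hX hXc
    have hins : X.biUnion nb \ insert b W = (X.biUnion nb \ W).erase b := by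
      ext y; simp only [mem_sdiff, mem_insert, mem_erase]; tauto
    rw [hins] at hlt'
    -- If `a ∈ X`, the demand drops by one along with the supply, and nothing is violated.
    have haX : a ∉ X := by
      intro haX
      have h₁ : ∑ x ∈ X, Function.update r a (r a - 1) x + 1 = ∑ x ∈ X, r x := by
        rw [Finset.sum_update_of_mem haX, ← Finset.add_sum_erase X r haX,
          Finset.sdiff_singleton_eq_erase]
        omega
      have h₂ := Finset.pred_card_le_card_erase (s := X.biUnion nb \ W) (a := b)
      omega
    rw [Finset.sum_update_of_notMem haX] at hlt'
    by_cases hbX : b ∈ X.biUnion nb \ W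
    · rw [Finset.card_erase_of_mem hbX] at hlt'
      have he : #(X.biUnion nb \ W) = ∑ x ∈ X, r x := by omega
      exact ⟨X, ⟨hX, hlt X hX hXc he, haX, he⟩, (mem_sdiff.1 hbX).1⟩
    · rw [Finset.erase_eq_of_notMem hbX] at hlt'
      omega
  -- Supply is submodular and demand is modular, so equality passes to unions.
  have hunion : ∀ X Y, Tight X → Tight Y → Tight (X ∪ Y) := by
    rintro X Y ⟨hX, hXc, haX, heX⟩ ⟨hY, hYc, haY, heY⟩
    have hsub : X ∪ Y ⊆ A' := union_subset hX hY
    have hc : #(X ∪ Y) ≤ 2 * m := (card_union_le X Y).trans (by omega)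
    have h₁ := hsmall _ hsub hc
    have h₂ := hsmall (X ∩ Y) (inter_subset_left.trans hX)
      ((card_le_card inter_subset_left).trans (by omega))
    have h₃ := Finset.sum_union_inter (s₁ := X) (s₂ := Y) (f := r)
    have h₄ := Finset.card_union_add_card_inter (X.biUnion nb \ W) (Y.biUnion nb \ W)
    have h₅ : (X ∪ Y).biUnion nb \ W = (X.biUnion nb \ W) ∪ (Y.biUnion nb \ W) := by
      rw [Finset.union_biUnion, Finset.union_sdiff_distrib]
    have h₆ : #((X ∩ Y).biUnion nb \ W) ≤ #((X.biUnion nb \ W) ∩ (Y.biUnion nb \ W)) := by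
      refine card_le_card fun y hy ↦ ?_
      simp only [mem_sdiff, mem_biUnion, mem_inter] at hy ⊢
      obtain ⟨⟨x, ⟨hx, hx'⟩, hxy⟩, hyW⟩ := hy
      exact ⟨⟨⟨x, hx, hxy⟩, hyW⟩, ⟨x, hx', hxy⟩, hyW⟩
    rw [h₅] at h₁
    have he : #((X ∪ Y).biUnion nb \ W) = ∑ x ∈ X ∪ Y, r x := by rw [h₅]; omega
    exact ⟨hsub, hlt _ hsub hc he, by simp [haX, haY], he⟩
  have hall : ∀ s ⊆ nb a \ W, ∃ X, Tight X ∧ s ⊆ X.biUnion nb := by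
    intro s
    induction s using Finset.induction_on with
    | empty => exact fun _ ↦ ⟨∅, ⟨by simp, by simp, by simp, by simp⟩, by simp⟩
    | insert b s hb ih =>
      intro hs
      obtain ⟨X, hX, hsX⟩ := ih ((subset_insert _ _).trans hs)
      obtain ⟨Y, hY, hbY⟩ := hex b (hs (mem_insert_self _ _))
      refine ⟨X ∪ Y, hunion X Y hX hY, ?_⟩
      rw [Finset.union_biUnion]
      exact insert_subset (mem_union_right _ hbY) (hsX.trans subset_union_left)
  obtain ⟨X, ⟨hX, hXc, haX, he⟩, hsub⟩ := hall _ subset_rfl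
  -- All candidates for `a` already lie in the supply of the tight set `X`; adding `a` raises the
  -- demand but not the supply.
  have h₁ := hsmall (insert a X) (insert_subset ha hX)
    ((card_insert_le _ _).trans (by omega))
  rw [Finset.sum_insert haX] at h₁
  have h₂ : (insert a X).biUnion nb \ W ⊆ X.biUnion nb \ W := by
    rw [Finset.biUnion_insert, Finset.union_sdiff_distrib]
    refine union_subset (fun y hy ↦ mem_sdiff.2 ⟨hsub hy, (mem_sdiff.1 hy).2⟩) subset_rfl
  have := card_le_card h₂
  omega

/-- If large sets of half-edges see almost everything, then after deleting a small set of
half-edges and their endpoints, small sets expand as well. -/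
theorem Finset.exists_expanding_core {V : Type*} [Fintype V] [DecidableEq V]
    (Γ : V × Bool → Finset V) {k d : ℕ} (hn : (4 * d + 9) * k ≤ Fintype.card V)
    (hbig : ∀ X, 2 * k ≤ #X → Fintype.card V < #(X.biUnion Γ) + k) :
    ∃ Z : Finset (V × Bool), #Z < 2 * k ∧ ∀ X, Disjoint X Z → #X ≤ 4 * k →
      (d + 1) * #X ≤ #(X.biUnion Γ \ Z.image Prod.fst) := by
  let P : Finset (V × Bool) → Prop := fun Z ↦
    #Z ≤ 4 * k ∧ #(Z.biUnion Γ \ Z.image Prod.fst) ≤ (d + 1) * #Z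
  classical
  -- Take a largest non-expanding set: a non-expanding set disjoint from it could be merged into it.
  obtain ⟨Z, hZ, hmax⟩ := Finset.exists_max_image (univ.filter P) Finset.card
    ⟨∅, by simp [P]⟩
  simp only [mem_filter, mem_univ, true_and] at hZ hmax
  have hcard : ∀ X Z : Finset (V × Bool), 2 * k ≤ #X →
      Fintype.card V < #(X.biUnion Γ \ Z.image Prod.fst) + k + #Z := by
    intro X Z hX
    have h₁ := hbig X hX
    have h₂ := Finset.le_card_sdiff (Z.image Prod.fst) (X.biUnion Γ)
    have h₃ : #(Z.image Prod.fst) ≤ #Z := card_image_le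
    omega
  -- A set of at least `2 * k` half-edges keeps more than `(4 * d + 9) * k - k - 4 * k = (d + 1) *
  -- (4 * k)` vertices, so it is never non-expanding.
  have hexp : (4 * d + 9) * k = 4 * (d * k) + 9 * k := by ring
  have hZ2 : #Z < 2 * k := by
    by_contra! h
    have h₁ := hcard Z Z h
    have h₂ : (d + 1) * #Z ≤ (d + 1) * (4 * k) := Nat.mul_le_mul_left _ hZ.1
    have h₃ : (d + 1) * (4 * k) = 4 * (d * k) + 4 * k := by ring
    have := hZ.1
    have := hZ.2
    omega
  refine ⟨Z, hZ2, fun X hXZ hX ↦ ?_⟩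
  by_contra! hlt
  have hX2 : #X < 2 * k := by
    by_contra! h
    have h₁ := hcard X Z h
    have h₂ : (d + 1) * #X ≤ (d + 1) * (4 * k) := Nat.mul_le_mul_left _ hX
    have h₃ : (d + 1) * (4 * k) = 4 * (d * k) + 4 * k := by ring
    omega
  have hXpos : 0 < #X := by
    by_contra! h
    simp [Nat.le_zero.1 h] at hlt
  have hc : #(Z ∪ X) = #Z + #X := card_union_of_disjoint hXZ.symm
  have hP : P (Z ∪ X) := by
    refine ⟨by omega, ?_⟩
    have hsub : (Z ∪ X).biUnion Γ \ (Z ∪ X).image Prod.fst ⊆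
        (Z.biUnion Γ \ Z.image Prod.fst) ∪ (X.biUnion Γ \ Z.image Prod.fst) := by
      rw [Finset.union_biUnion, ← Finset.union_sdiff_distrib]
      exact Finset.sdiff_subset_sdiff subset_rfl (image_subset_image subset_union_left)
    have h₁ := (card_le_card hsub).trans (card_union_le _ _)
    have h₂ := hZ.2
    rw [hc, mul_add]
    omega
  have := hmax _ hP
  omega

/-! ### Almost spanning trees in digraphs with joined large sets. -/

namespace Digraph

variable {V : Type*}

/-- `y` is an out-neighbour (`o = true`) or an in-neighbour (`o = false`) of `x`. -/
def DirAdj (D : Digraph V) (o : Bool) (x y : V) : Prop :=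
  if o then D.Adj x y else D.Adj y x

@[simp] lemma dirAdj_true (D : Digraph V) (x y : V) : D.DirAdj true x y ↔ D.Adj x y := by
  simp [DirAdj]

@[simp] lemma dirAdj_false (D : Digraph V) (x y : V) : D.DirAdj false x y ↔ D.Adj y x := by
  simp [DirAdj]

lemma dirAdj_not (D : Digraph V) (o : Bool) (x y : V) : D.DirAdj (!o) x y ↔ D.DirAdj o y x := by
  cases o <;> simp

open Classical in
/-- The out-neighbours (`o = true`) or in-neighbours (`o = false`) of `x`. -/
noncomputable def dirNbrs [Fintype V] (D : Digraph V) (o : Bool) (x : V) : Finset V :=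
  univ.filter (D.DirAdj o x)

@[simp] lemma mem_dirNbrs [Fintype V] (D : Digraph V) (o : Bool) (x y : V) :
    y ∈ D.dirNbrs o x ↔ D.DirAdj o x y := by
  simp [dirNbrs]

/-- Any two sets of at least `k` vertices are joined by an edge in each direction. -/
def Joined (R : Digraph V) (k : ℕ) : Prop :=
  ∀ X Y : Finset V, k ≤ #X → k ≤ #Y → ∃ x ∈ X, ∃ y ∈ Y, R.Adj x y

lemma Joined.exists_dirAdj {R : Digraph V} {k : ℕ} (hR : R.Joined k) (o : Bool) {X Y : Finset V}
    (hX : k ≤ #X) (hY : k ≤ #Y) : ∃ x ∈ X, ∃ y ∈ Y, R.DirAdj o x y := by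
  cases o
  · obtain ⟨y, hy, x, hx, h⟩ := hR Y X hY hX
    exact ⟨x, hx, y, hy, by simpa⟩
  · simpa using hR X Y hX hY

lemma IsOrientedTree.adj_iff {T : Digraph V} (hT : T.IsOrientedTree) (a b : V) :
    T.toSimpleGraphInclusive.Adj a b ↔ ∃ o, T.DirAdj o a b := by
  simp only [toSimpleGraphInclusive, SimpleGraph.fromRel_adj, Bool.exists_bool, dirAdj_false,
    dirAdj_true]
  constructor
  · rintro ⟨-, h⟩; exact h.symm
  · intro h
    refine ⟨?_, h.symm⟩
    rintro rfl
    exact hT.1 a (h.elim id id)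

/-- A connected proper part of an oriented tree can be extended by a vertex with exactly one
neighbour in it. -/
lemma IsOrientedTree.exists_rootedIn_insert [Fintype V] [DecidableEq V] {T : Digraph V}
    (hT : T.IsOrientedTree) {r : V} {S : Finset V} (hr : r ∈ S)
    (hS : T.toSimpleGraphInclusive.RootedIn r S) (hne : S ≠ univ) :
    ∃ q ∉ S, ∃ s ∈ S, ∃ o, T.DirAdj o s q ∧
      (∀ a ∈ S, ∀ o', T.DirAdj o' a q → a = s ∧ o' = o) ∧
      T.toSimpleGraphInclusive.RootedIn r (insert q S) := by
  obtain ⟨q, hq, s, hs, hsq, huniq, hroot⟩ := hT.2.2.exists_rootedIn_insert hr hS hne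
  obtain ⟨o, ho⟩ := (hT.adj_iff s q).1 hsq
  refine ⟨q, hq, s, hs, o, ho, fun a ha o' h ↦ ?_, hroot⟩
  obtain rfl := huniq a ha ((hT.adj_iff a q).2 ⟨o', h⟩)
  refine ⟨rfl, ?_⟩
  by_contra hne
  have h1 := hT.2.1 a q
  have h2 := hT.2.1 q a
  cases o <;> cases o' <;> simp_all

/-- `φ` maps the edges of `T` inside `S` to edges of `D`. -/
def EmbedsOn {W : Type*} (T : Digraph V) (D : Digraph W) (S : Finset V) (φ : V → W) : Prop :=
  ∀ a ∈ S, ∀ b ∈ S, T.Adj a b → D.Adj (φ a) (φ b)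

lemma embedsOn_of_dirAdj {W : Type*} {T : Digraph V} {D : Digraph W} {S : Finset V} {φ : V → W}
    [DecidableEq V] {q : V} (hT : T.Loopless) (hS : T.EmbedsOn D S φ)
    (h : ∀ a ∈ S, ∀ o, T.DirAdj o a q → D.DirAdj o (φ a) (φ q)) :
    T.EmbedsOn D (insert q S) φ := by
  intro a ha b hb hab
  rcases Finset.mem_insert.1 ha with rfl | ha' <;> rcases Finset.mem_insert.1 hb with rfl | hb'
  · exact absurd hab (hT _)
  · simpa using h b hb' false (by simpa using hab)
  · simpa using h a ha' true (by simpa using hab)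
  · exact hS a ha' b hb' hab

/-- Some `k` of the half-edges share a direction, hence have distinct endpoints; a set of `k`
vertices missed by all of them would contradict `Joined`. -/
lemma Joined.card_lt_card_biUnion [Fintype V] [DecidableEq V] {R : Digraph V} {k : ℕ}
    (hR : R.Joined k) (X : Finset (V × Bool)) (hX : 2 * k ≤ #X) :
    Fintype.card V < #(X.biUnion fun z ↦ R.dirNbrs z.2 z.1) + k := by
  obtain ⟨o, ho⟩ : ∃ o, k ≤ #(X.filter fun z ↦ z.2 = o) := by
    by_contra! h
    have h₁ := h true
    have h₂ := h false
    have h₃ := Finset.card_filter_add_card_filter_not (s := X) (fun z ↦ z.2 = true)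
    simp only [Bool.not_eq_true] at h₃
    omega
  have himg : k ≤ #((X.filter fun z ↦ z.2 = o).image Prod.fst) := by
    rwa [Finset.card_image_of_injOn]
    rintro ⟨x, a⟩ hx ⟨y, b⟩ hy (rfl : x = y)
    simp only [coe_filter, Set.mem_ofPred_eq] at hx hy
    rw [hx.2, hy.2]
  by_contra! h
  obtain ⟨x, hx, y, hy, hxy⟩ := hR.exists_dirAdj o himg
    (Y := (X.biUnion fun z ↦ R.dirNbrs z.2 z.1)ᶜ) (by rw [card_compl]; omega)
  simp only [mem_image, mem_filter, Prod.exists, exists_and_right, exists_eq_right] at hx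
  exact (mem_compl.1 hy) (mem_biUnion.2 ⟨_, hx, by simpa using hxy⟩)

/-- A digraph in which large sets are joined contains every almost spanning oriented tree of
bounded degree. -/
theorem Joined.exists_embedsOn [Fintype V] [DecidableEq V] {R T : Digraph V} {k d : ℕ}
    (hk : 1 ≤ k) (hR : R.Joined k) (hT : T.IsOrientedTree) (hd : ∀ o v, #(T.dirNbrs o v) ≤ d)
    (hn : (4 * d + 9) * k < Fintype.card V) :
    ∃ (r : V) (S : Finset V) (φ : Equiv.Perm V), r ∈ S ∧
      T.toSimpleGraphInclusive.RootedIn r S ∧ Fintype.card V = #S + (4 * d + 9) * k ∧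
      T.EmbedsOn R S φ := by
  obtain ⟨Z, hZ, hcore⟩ := Finset.exists_expanding_core (fun z ↦ R.dirNbrs z.2 z.1) hn.le
    hR.card_lt_card_biUnion
  set nb : V × Bool → Finset V := fun z ↦ R.dirNbrs z.2 z.1 \ Z.image Prod.fst with hnb
  have hbU : ∀ X : Finset (V × Bool), X.biUnion nb =
      (X.biUnion fun z ↦ R.dirNbrs z.2 z.1) \ Z.image Prod.fst := by
    intro X; ext y; simp only [hnb, mem_biUnion, mem_sdiff]; tauto
  have hexp : (4 * d + 9) * k = 4 * (d * k) + 9 * k := by ring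
  obtain ⟨root⟩ := hT.2.2.connected.nonempty
  -- The demand `r (x, o)` bounds the number of tree neighbours in direction `o` still to be
  -- attached at `x`; it stays `d` at unused `x`. Images avoid the endpoints of `Z`, so every
  -- half-edge that makes a request lies in `Zᶜ`, where the Hall condition holds.
  have key : ∀ j, 1 ≤ j → j + (4 * d + 9) * k ≤ Fintype.card V →
      ∃ (S : Finset V) (ψ : V → V) (r : V × Bool → ℕ), #S = j ∧ root ∈ S ∧
        T.toSimpleGraphInclusive.RootedIn root S ∧ Set.InjOn ψ S ∧
        (∀ v ∈ S, ψ v ∉ Z.image Prod.fst) ∧ T.EmbedsOn R S ψ ∧ (∀ z, r z ≤ d) ∧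
        (∀ v ∈ S, ∀ o, #(T.dirNbrs o v \ S) ≤ r (ψ v, o)) ∧
        (∀ x ∉ S.image ψ, ∀ o, r (x, o) = d) ∧
        ∀ X ⊆ Zᶜ, #X ≤ 2 * (2 * k) → ∑ x ∈ X, r x ≤ #(X.biUnion nb \ S.image ψ) := by
    intro j hj
    induction j, hj using Nat.le_induction with
    | base =>
      intro hle
      obtain ⟨x₀, hx₀⟩ : ∃ x₀, x₀ ∉ Z.image Prod.fst := by
        by_contra! h
        have h₁ : Fintype.card V ≤ #(Z.image Prod.fst) := by
          rw [← card_univ]; exact card_le_card fun x _ ↦ h x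
        have h₂ : #(Z.image Prod.fst) ≤ #Z := card_image_le
        omega
      refine ⟨{root}, fun _ ↦ x₀, fun _ ↦ d, by simp, by simp,
        SimpleGraph.rootedIn_singleton _ _, by simp, by simpa using hx₀, ?_, by simp, ?_, by simp,
        ?_⟩
      · intro a ha b hb hab
        rw [mem_singleton] at ha hb
        subst ha hb
        exact absurd hab (hT.1 _)
      · intro v _ o
        exact (card_le_card sdiff_subset).trans (hd o v)
      · intro X hX hXc
        rcases X.eq_empty_or_nonempty with rfl | hne
        · simp
        -- The surplus of the factor `d + 1` over `d` pays for the vertex used by the root.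
        have h₁ := hcore X (disjoint_left.2 fun z hz ↦ mem_compl.1 (hX hz)) (by omega)
        rw [← hbU] at h₁
        have h₂ := Finset.le_card_sdiff (image (fun _ ↦ x₀) ({root} : Finset V)) (X.biUnion nb)
        simp only [image_singleton, card_singleton] at h₂ ⊢
        have h₃ := hne.card_pos
        rw [sum_const, smul_eq_mul]
        have h₄ : (d + 1) * #X = #X * d + #X := by ring
        omega
    | succ j hj ih =>
      intro hle
      obtain ⟨S, ψ, r, hSc, hrS, hroot, hinj, hZS, hemb, hrd, hdem, hfresh, hsmall⟩ :=
        ih (by omega)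
      have hSne : S ≠ univ := by
        rintro rfl
        rw [card_univ] at hSc
        omega
      obtain ⟨q, hq, s, hs, o, hsq, huniq, hroot'⟩ := hT.exists_rootedIn_insert hrS hroot hSne
      -- Such a set misses fewer than `k` vertices, `Z` costs fewer than `2 * k` and `S` at most
      -- `j`; the `(4 * d + 9) * k` vertices held back leave more than `4 * d * k`.
      have hlarge : ∀ X ⊆ Zᶜ, 2 * k ≤ #X → #X ≤ 2 * (2 * k) →
          2 * (2 * k) * d < #(X.biUnion nb \ S.image ψ) := by
        intro X hX hX1 hX2
        have h₁ := hR.card_lt_card_biUnion X hX1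
        have h₂ := Finset.le_card_sdiff (Z.image Prod.fst)
          (X.biUnion fun z ↦ R.dirNbrs z.2 z.1)
        have h₃ : #(Z.image Prod.fst) ≤ #Z := card_image_le
        have h₄ := Finset.le_card_sdiff (S.image ψ) (X.biUnion nb)
        have h₅ : #(S.image ψ) ≤ #S := card_image_le
        rw [hbU] at h₄ ⊢
        have h₆ : 2 * (2 * k) * d = 4 * (d * k) := by ring
        omega
      have hmem : (ψ s, o) ∈ Zᶜ := by
        rw [mem_compl]
        exact fun h ↦ hZS s hs (mem_image_of_mem Prod.fst h)
      have hpos : 0 < r (ψ s, o) :=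
        (card_pos.2 ⟨q, by simp [hsq, hq]⟩).trans_le (hdem s hs o)
      obtain ⟨b, hb, hbS, hsmall'⟩ := Finset.exists_online_match nb Zᶜ (S.image ψ) r
        (by omega) hrd hsmall hlarge hmem hpos
      have hψ : ∀ v ∈ S, Function.update ψ q b v = ψ v := fun v hv ↦
        Function.update_of_ne (ne_of_mem_of_not_mem hv hq) _ _
      have hψq : Function.update ψ q b q = b := Function.update_self _ _ _
      have himg : (insert q S).image (Function.update ψ q b) = insert b (S.image ψ) := by
        rw [image_insert, hψq, image_congr (g := ψ) hψ]
      simp only [hnb, mem_sdiff, mem_dirNbrs] at hb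
      refine ⟨insert q S, Function.update ψ q b,
        Function.update r (ψ s, o) (r (ψ s, o) - 1), by rw [card_insert_of_notMem hq, hSc],
        mem_insert_of_mem hrS, hroot', ?_, ?_, ?_, ?_, ?_, ?_, ?_⟩
      · rw [coe_insert, Set.injOn_insert (by simpa using hq)]
        refine ⟨hinj.congr fun v hv ↦ (hψ v hv).symm, ?_⟩
        rw [hψq]
        rintro ⟨v, hv, hvb⟩
        rw [hψ v hv] at hvb
        exact hbS (mem_image.2 ⟨v, hv, hvb⟩)
      · intro v hv
        rcases mem_insert.1 hv with rfl | hv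
        · rw [hψq]; exact hb.2
        · rw [hψ v hv]; exact hZS v hv
      · refine embedsOn_of_dirAdj hT.1 ?_ ?_
        · intro a ha b' hb' hab
          rw [hψ a ha, hψ b' hb']
          exact hemb a ha b' hb' hab
        · intro a ha o' h
          obtain ⟨rfl, rfl⟩ := huniq a ha o' h
          rw [hψ a ha, hψq]
          exact hb.1
      · intro z
        by_cases hz : z = (ψ s, o)
        · subst hz; simpa using (hrd (ψ s, o)).trans (by omega)
        · rw [Function.update_of_ne hz]; exact hrd z
      · intro v hv o'
        rcases mem_insert.1 hv with rfl | hv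
        · rw [hψq, Function.update_of_ne, hfresh b hbS]
          · exact (card_le_card sdiff_subset).trans (hd o' v)
          · rintro ⟨rfl, -⟩
            exact hbS (mem_image_of_mem ψ hs)
        · rw [hψ v hv]
          by_cases hz : (ψ v, o') = (ψ s, o)
          · obtain ⟨hvs, rfl⟩ := Prod.mk.inj hz
            obtain rfl := hinj hv hs hvs
            rw [Function.update_self]
            have h₁ := hdem v hv o'
            have h₂ : T.dirNbrs o' v \ insert q S = (T.dirNbrs o' v \ S).erase q := by
              ext y; simp only [mem_sdiff, mem_insert, mem_erase]; tauto
            rw [h₂, card_erase_of_mem (by simp [hsq, hq])]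
            omega
          · rw [Function.update_of_ne hz]
            exact (card_le_card (sdiff_subset_sdiff subset_rfl (subset_insert _ _))).trans
              (hdem v hv o')
      · intro x hx o'
        rw [himg, mem_insert, not_or] at hx
        rw [Function.update_of_ne, hfresh x hx.2]
        rintro ⟨rfl, -⟩
        exact hx.2 (mem_image_of_mem ψ hs)
      · rw [himg]; exact hsmall'
  obtain ⟨S, ψ, -, hSc, hrS, hroot, hinj, -, hemb, -⟩ :=
    key (Fintype.card V - (4 * d + 9) * k) (by omega) (by omega)
  -- Outside `S` the values are arbitrary: they assign a spare image to each missing vertex.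
  obtain ⟨g, hg⟩ := Finset.exists_equiv_extend_of_card_eq (t := (univ : Finset V))
    (by simp) (s := S) (f := ψ) (by simp) hinj
  refine ⟨root, S, g.trans (Equiv.subtypeUnivEquiv (by simp)), hrS, hroot, by omega, ?_⟩
  intro a ha b hb hab
  simpa [hg a ha, hg b hb] using hemb a ha b hb hab

end Digraph

/-! ### Completing an embedding by switchings. -/

namespace Digraph

variable {V : Type*}

open Classical in
/-- The vertices `p` of `T` such that, for the embedding `φ`, the image of `p` is an out- or
in-neighbour of `u` in `D`, and the image of `p` may be replaced by `w` using edges of `D`. -/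
noncomputable def switchable [Fintype V] (T D : Digraph V) (φ : V → V) (o : Bool) (u w : V) :
    Finset V :=
  univ.filter fun p ↦ D.DirAdj o u (φ p) ∧ ∀ o' a, T.DirAdj o' p a → D.DirAdj o' w (φ a)

lemma DirAdj.sup_left {D : Digraph V} {o : Bool} {x y : V} (h : D.DirAdj o x y) (R : Digraph V) :
    (D ⊔ R).DirAdj o x y := by
  cases o <;> simp_all

/-- An almost spanning embedding of a tree can be completed by switchings along edges of `D`. -/
theorem contained_of_switchable [Fintype V] [DecidableEq V] {T D R : Digraph V} {d l : ℕ}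
    (hT : T.IsOrientedTree) (hd : ∀ o v, #(T.dirNbrs o v) ≤ d) {r : V} {S : Finset V}
    {φ : Equiv.Perm V} (hr : r ∈ S) (hS : T.toSimpleGraphInclusive.RootedIn r S)
    (hcard : Fintype.card V = #S + l) (hφ : T.EmbedsOn R S φ)
    (hsw : ∀ o u w, (4 * d + 3) * l + 2 ≤ #(switchable T D φ o u w)) :
    T.Contained (D ⊔ R) := by
  have key : ∀ j ≤ l, ∃ (S' : Finset V) (θ : Equiv.Perm V), S ⊆ S' ∧ #S' = #S + j ∧
      T.toSimpleGraphInclusive.RootedIn r S' ∧ T.EmbedsOn (D ⊔ R) S' θ ∧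
      #(univ.filter fun p ↦ θ p ≠ φ p) ≤ 2 * j := by
    intro j
    induction j with
    | zero =>
      intro _
      exact ⟨S, φ, subset_rfl, rfl, hS, fun a ha b hb hab ↦ Or.inr (hφ a ha b hb hab), by simp⟩
    | succ j ih =>
      intro hj
      obtain ⟨S', θ, hSS, hSc, hroot, hθ, hM⟩ := ih (by omega)
      set M : Finset V := univ.filter fun p ↦ θ p ≠ φ p with hMdef
      obtain ⟨q, hq, s, hs, o, hsq, huniq, hroot'⟩ :=
        hT.exists_rootedIn_insert (hSS hr) hroot (by rintro rfl; rw [card_univ] at hSc; omega)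
      -- Outside this set, `p` and all its tree neighbours still have their images under `φ`, `p ≠
      -- s`, and `p ∈ S` gives `p ≠ q`. As `#M ≤ 2 * l`, at most `2 * l * (2 * d + 1) + l + 1`
      -- vertices are excluded.
      let bad : Finset V := ((M ∪ M.biUnion (T.dirNbrs true)) ∪ M.biUnion (T.dirNbrs false)) ∪
        (insert s Sᶜ)
      have hbad : #bad < #(switchable T D φ o (θ s) (θ q)) := by
        have h₁ : #bad ≤ #M + #M * d + #M * d + (#Sᶜ + 1) :=
          (card_union_le _ _).trans (add_le_add ((card_union_le _ _).trans
            (add_le_add ((card_union_le _ _).trans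
              (add_le_add le_rfl (card_biUnion_le_card_mul _ _ _ fun v _ ↦ hd true v)))
              (card_biUnion_le_card_mul _ _ _ fun v _ ↦ hd false v))) (card_insert_le _ _))
        have h₂ : #Sᶜ = l := by rw [card_compl]; omega
        have h₃ : #M + #M * d + #M * d = #M * (2 * d + 1) := by ring
        have h₄ : #M * (2 * d + 1) ≤ 2 * l * (2 * d + 1) := Nat.mul_le_mul_right _ (by omega)
        have h₅ := hsw o (θ s) (θ q)
        have h₆ : (4 * d + 3) * l = 2 * l * (2 * d + 1) + l := by ring
        omega
      obtain ⟨p, hp, hpbad⟩ := Finset.exists_mem_notMem_of_card_lt_card hbad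
      simp only [switchable, mem_filter, mem_univ, true_and] at hp
      simp only [bad, mem_union, mem_insert, mem_compl, not_or, not_not] at hpbad
      obtain ⟨⟨⟨hpM, hp1⟩, hp2⟩, hps, hpS⟩ := hpbad
      have hMnbr : ∀ o' a, T.DirAdj o' p a → a ∉ M := by
        intro o' a h haM
        rw [← dirAdj_not] at h
        cases o'
        · exact hp1 (mem_biUnion.2 ⟨a, haM, by simpa using h⟩)
        · exact hp2 (mem_biUnion.2 ⟨a, haM, by simpa using h⟩)
      have hMeq : ∀ a, a ∉ M → θ a = φ a := by
        intro a ha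
        simpa [hMdef] using ha
      have hpq : p ≠ q := ne_of_mem_of_not_mem (hSS hpS) hq
      -- Now `q` takes the image of `p`, a `D`-neighbour of `θ s`, while `p` moves to the spare
      -- vertex `θ q`.
      let θ' : Equiv.Perm V := (Equiv.swap p q).trans θ
      have hθp : θ' p = θ q := by simp [θ']
      have hθq : θ' q = θ p := by simp [θ']
      have hθne : ∀ a, a ≠ p → a ≠ q → θ' a = θ a := by
        intro a h₁ h₂
        simp [θ', Equiv.swap_apply_of_ne_of_ne h₁ h₂]
      have hatp : ∀ a ∈ S', ∀ o', T.DirAdj o' p a → (D ⊔ R).DirAdj o' (θ' p) (θ' a) := by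
        intro a ha o' h
        have hap : a ≠ p := by
          rintro rfl
          exact hT.1 a (by cases o' <;> simpa using h)
        rw [hθp, hθne a hap (ne_of_mem_of_not_mem ha hq), hMeq a (hMnbr o' a h)]
        exact (hp.2 o' a h).sup_left R
      refine ⟨insert q S', θ', hSS.trans (subset_insert _ _), by
        rw [card_insert_of_notMem hq, hSc, add_assoc], hroot', ?_, ?_⟩
      · refine embedsOn_of_dirAdj hT.1 ?_ ?_
        · intro a ha b hb hab
          by_cases hap : a = p
          · subst hap
            simpa using hatp b hb true (by simpa using hab)
          by_cases hbp : b = p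
          · subst hbp
            simpa using hatp a ha false (by simpa using hab)
          rw [hθne a hap (ne_of_mem_of_not_mem ha hq), hθne b hbp (ne_of_mem_of_not_mem hb hq)]
          exact hθ a ha b hb hab
        · intro a ha o' h
          obtain ⟨rfl, rfl⟩ := huniq a ha o' h
          rw [hθq, hθne a (Ne.symm hps) (ne_of_mem_of_not_mem ha hq), hMeq p hpM]
          exact hp.1.sup_left R
      · have hsub : (univ.filter fun a ↦ θ' a ≠ φ a) ⊆ insert p (insert q M) := by
          intro a ha
          simp only [mem_filter, mem_univ, true_and] at ha
          by_contra h
          simp only [mem_insert, not_or] at h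
          exact ha ((hθne a h.1 h.2.1).trans (hMeq a h.2.2))
        have h₁ := card_le_card hsub
        have h₂ := card_insert_le p (insert q M)
        have h₃ := card_insert_le q M
        omega
  obtain ⟨S', θ, -, hSc, -, hθ, -⟩ := key l le_rfl
  have hu : S' = univ := by rw [← card_eq_iff_eq_univ]; omega
  exact ⟨θ, θ.injective, fun a b hab ↦ hθ a (by simp [hu]) b (by simp [hu]) hab⟩

end Digraph

/-! ### Concentration for uniformly random permutations. -/

section Perm

variable {V : Type*} [Fintype V] [DecidableEq V]

/-- Conditionally on the values of a uniformly random permutation on a set `Q`, its value at a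
point outside `Q` hits `Y` with probability at least `β`. -/
theorem Equiv.Perm.mul_sum_le_sum_ite_mem {g : Equiv.Perm V → ℝ} (hg0 : ∀ π, 0 ≤ g π)
    {Q : Finset V} (hg : ∀ π σ : Equiv.Perm V, (∀ x ∈ Q, σ x = x) → g (π * σ) = g π)
    {r : V} (hr : r ∉ Q) {Y : Finset V} {β : ℝ} (hY : β * Fintype.card V + #Q ≤ #Y) :
    β * ∑ π, g π ≤ ∑ π : Equiv.Perm V, if π r ∈ Y then g π else 0 := by
  set s : ℝ := ∑ π : Equiv.Perm V, if π r ∈ Y then g π else 0 with hs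
  have hs0 : 0 ≤ s := sum_nonneg fun π _ ↦ by split_ifs <;> simp [hg0]
  -- Swapping `r` and `r'` does not affect `g`, so all points outside `Q` play the same role and one
  -- may average over them.
  have hswap : ∀ r' ∈ Qᶜ, (∑ π : Equiv.Perm V, if π r' ∈ Y then g π else 0) = s := by
    intro r' hr'
    rw [mem_compl] at hr'
    rw [hs, ← Equiv.sum_comp (Equiv.mulRight (Equiv.swap r r'))]
    refine sum_congr rfl fun π _ ↦ ?_
    simp only [Equiv.coe_mulRight, Equiv.Perm.coe_mul, Function.comp_apply,
      Equiv.swap_apply_right]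
    rw [hg π (Equiv.swap r r')]
    intro x hx
    exact Equiv.swap_apply_of_ne_of_ne (ne_of_mem_of_not_mem hx hr)
      (ne_of_mem_of_not_mem hx hr')
  have hcard : (0 : ℝ) < Fintype.card V := by
    exact_mod_cast Fintype.card_pos_iff.2 ⟨r⟩
  have h₁ : (#Qᶜ : ℝ) * s = ∑ π : Equiv.Perm V, (#(Qᶜ.filter fun r' ↦ π r' ∈ Y) : ℝ) * g π := by
    rw [← nsmul_eq_mul, ← sum_const, ← sum_congr rfl hswap, sum_comm]
    refine sum_congr rfl fun π _ ↦ ?_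
    rw [← sum_filter, sum_const, nsmul_eq_mul]
  -- At most `#Q` elements of `Y` are images of points of `Q`.
  have h₂ : ∀ π : Equiv.Perm V, β * Fintype.card V ≤ #(Qᶜ.filter fun r' ↦ π r' ∈ Y) := by
    intro π
    have h : Y ⊆ (Qᶜ.filter fun r' ↦ π r' ∈ Y).image π ∪ Q.image π := by
      intro y hy
      by_cases h : π.symm y ∈ Q
      · exact mem_union_right _ (mem_image.2 ⟨_, h, by simp⟩)
      · exact mem_union_left _ (mem_image.2 ⟨π.symm y, by simp [h, hy], by simp⟩)
    have h' : #Y ≤ #(Qᶜ.filter fun r' ↦ π r' ∈ Y) + #Q :=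
      (card_le_card h).trans ((card_union_le _ _).trans (add_le_add card_image_le card_image_le))
    have h'' : (#Y : ℝ) ≤ #(Qᶜ.filter fun r' ↦ π r' ∈ Y) + #Q := by exact_mod_cast h'
    linarith
  have h₃ : β * Fintype.card V * ∑ π, g π ≤ #Qᶜ * s := by
    rw [h₁, mul_sum]
    exact sum_le_sum fun π _ ↦ mul_le_mul_of_nonneg_right (h₂ π) (hg0 π)
  have h₄ : (#Qᶜ : ℝ) * s ≤ Fintype.card V * s :=
    mul_le_mul_of_nonneg_right (by exact_mod_cast card_le_univ _) hs0
  refine le_of_mul_le_mul_left ?_ hcard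
  linarith

/-- The version of `Equiv.Perm.mul_sum_le_sum_ite_mem` for several new points. -/
theorem Equiv.Perm.pow_mul_sum_le_sum_ite_forall_mem {g : Equiv.Perm V → ℝ} (hg0 : ∀ π, 0 ≤ g π)
    {Q : Finset V} (hg : ∀ π σ : Equiv.Perm V, (∀ x ∈ Q, σ x = x) → g (π * σ) = g π)
    {β : ℝ} (hβ : 0 ≤ β) (Y : V → Finset V) (P : Finset V) (hPQ : _root_.Disjoint P Q)
    (hY : ∀ x, β * Fintype.card V + #Q + #P ≤ #(Y x)) :
    β ^ #P * ∑ π, g π ≤ ∑ π : Equiv.Perm V, if ∀ x ∈ P, π x ∈ Y x then g π else 0 := by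
  induction P using Finset.induction_on with
  | empty => simp
  | insert p P hp ih =>
    rw [card_insert_of_notMem hp] at hY ⊢
    push_cast at hY
    rw [disjoint_insert_left] at hPQ
    have h₁ := ih hPQ.2 fun x ↦ by linarith [hY x]
    have h₂ := Equiv.Perm.mul_sum_le_sum_ite_mem
      (g := fun π ↦ if ∀ x ∈ P, π x ∈ Y x then g π else 0) (Q := Q ∪ P) (r := p) (Y := Y p)
      (β := β) (fun π ↦ by split_ifs <;> simp [hg0]) ?_ (by simp [hp, hPQ.1]) ?_
    · calc β ^ (#P + 1) * ∑ π, g π = β * (β ^ #P * ∑ π, g π) := by ring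
        _ ≤ _ := mul_le_mul_of_nonneg_left h₁ hβ
        _ ≤ _ := h₂
        _ = _ := sum_congr rfl fun π _ ↦ by
          rw [← ite_and]
          simp only [mem_insert, forall_eq_or_imp]
    · intro π σ hσ
      have hP : ∀ x ∈ P, (π * σ) x = π x := fun x hx ↦ by
        rw [Equiv.Perm.mul_apply, hσ x (mem_union_right _ hx)]
      have hiff : (∀ x ∈ P, (π * σ) x ∈ Y x) ↔ ∀ x ∈ P, π x ∈ Y x :=
        forall₂_congr fun x hx ↦ by rw [hP x hx]
      simp only [hiff, hg π σ fun x hx ↦ hσ x (mem_union_left _ hx)]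
    · have h : (#(Q ∪ P) : ℝ) ≤ #Q + #P := by exact_mod_cast card_union_le Q P
      linarith [hY p]

/-- Exponential moment bound for the number of disjoint sets on which a uniformly random
permutation meets prescribed targets. -/
theorem Equiv.Perm.sum_prod_one_sub_le {β : ℝ} (hβ : 0 ≤ β) (hβ1 : β ≤ 1) {t : ℕ}
    (P : V → Finset V) (Y : V → V → Finset V) (I : Finset V)
    (hP : ∀ i ∈ I, #(P i) ≤ t) (hdisj : (I : Set V).PairwiseDisjoint P)
    (hY : ∀ i x, β * Fintype.card V + t * #I ≤ #(Y i x)) :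
    ∑ π : Equiv.Perm V, ∏ i ∈ I, (1 - if ∀ x ∈ P i, π x ∈ Y i x then (1 / 2 : ℝ) else 0) ≤
      (1 - β ^ t / 2) ^ #I * Fintype.card (Equiv.Perm V) := by
  induction I using Finset.induction_on with
  | empty => simp
  | insert j I hj ih =>
    rw [card_insert_of_notMem hj] at hY ⊢
    push_cast at hY
    have hI := ih (fun i hi ↦ hP i (mem_insert_of_mem hi))
      (hdisj.subset (by simp)) fun i x ↦ by nlinarith [hY i x]
    set g : Equiv.Perm V → ℝ := fun π ↦
      ∏ i ∈ I, (1 - if ∀ x ∈ P i, π x ∈ Y i x then (1 / 2 : ℝ) else 0) with hgdef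
    have hg0 : ∀ π, 0 ≤ g π := fun π ↦ prod_nonneg fun i _ ↦ by split_ifs <;> norm_num
    have hginv : ∀ π σ : Equiv.Perm V, (∀ x ∈ I.biUnion P, σ x = x) → g (π * σ) = g π := by
      intro π σ hσ
      refine prod_congr rfl fun i hi ↦ ?_
      have hiff : (∀ x ∈ P i, (π * σ) x ∈ Y i x) ↔ ∀ x ∈ P i, π x ∈ Y i x :=
        forall₂_congr fun x hx ↦ by
          rw [Equiv.Perm.mul_apply, hσ x (mem_biUnion.2 ⟨i, hi, hx⟩)]
      simp only [hiff]
    -- `g` depends only on the values on the earlier sets; given these, `P j` succeeds with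
    -- probability at least `β ^ t`. The slack `t * #I` in `hY` covers the points already revealed.
    have hstep := Equiv.Perm.pow_mul_sum_le_sum_ite_forall_mem hg0 hginv hβ (Y j) (P j) ?_ ?_
    · have hpow : β ^ t ≤ β ^ #(P j) := pow_le_pow_of_le_one hβ hβ1 (hP j (mem_insert_self _ _))
      have hsum0 : 0 ≤ ∑ π, g π := sum_nonneg fun π _ ↦ hg0 π
      have hq1 : β ^ t ≤ 1 := pow_le_one₀ hβ hβ1
      calc ∑ π : Equiv.Perm V, ∏ i ∈ insert j I,
              (1 - if ∀ x ∈ P i, π x ∈ Y i x then (1 / 2 : ℝ) else 0)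
          = ∑ π : Equiv.Perm V, (g π - (if ∀ x ∈ P j, π x ∈ Y j x then g π else 0) / 2) := by
            refine sum_congr rfl fun π _ ↦ ?_
            rw [prod_insert hj]
            simp only [hgdef]
            split_ifs <;> ring
        _ = ∑ π, g π - (∑ π : Equiv.Perm V,
              if ∀ x ∈ P j, π x ∈ Y j x then g π else 0) / 2 := by
            rw [sum_sub_distrib, sum_div]
        _ ≤ (1 - β ^ t / 2) * ∑ π, g π := by nlinarith
        _ ≤ (1 - β ^ t / 2) * ((1 - β ^ t / 2) ^ #I * Fintype.card (Equiv.Perm V)) :=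
            mul_le_mul_of_nonneg_left hI (by linarith)
        _ = _ := by ring
    · rw [disjoint_biUnion_right]
      intro i hi
      exact hdisj (by simp) (by simp [hi]) (fun h ↦ hj (h ▸ hi))
    · intro x
      have h₁ : #(I.biUnion P) ≤ #I * t :=
        card_biUnion_le_card_mul _ _ _ fun i hi ↦ hP i (mem_insert_of_mem hi)
      have h₂ : (#(I.biUnion P) : ℝ) ≤ #I * t := by exact_mod_cast h₁
      have h₃ : (#(P j) : ℝ) ≤ t := by exact_mod_cast hP j (mem_insert_self _ _)
      nlinarith [hY j x]

/-- Lower tail bound for the number of disjoint sets on which a uniformly random permutation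
meets prescribed targets. -/
theorem Equiv.Perm.card_filter_lt_le {β : ℝ} (hβ : 0 ≤ β) (hβ1 : β ≤ 1) {t : ℕ}
    (P : V → Finset V) (Y : V → V → Finset V) (I : Finset V)
    (hP : ∀ i ∈ I, #(P i) ≤ t) (hdisj : (I : Set V).PairwiseDisjoint P)
    (hY : ∀ i x, β * Fintype.card V + t * #I ≤ #(Y i x)) (K : ℕ) :
    (#(univ.filter fun π : Equiv.Perm V ↦ #(I.filter fun i ↦ ∀ x ∈ P i, π x ∈ Y i x) < K) : ℝ) ≤
      2 ^ K * (1 - β ^ t / 2) ^ #I * Fintype.card (Equiv.Perm V) := by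
  have h := Equiv.Perm.sum_prod_one_sub_le hβ hβ1 P Y I hP hdisj hY
  have hprod : ∀ π : Equiv.Perm V,
      ∏ i ∈ I, (1 - if ∀ x ∈ P i, π x ∈ Y i x then (1 / 2 : ℝ) else 0) =
        (1 / 2) ^ #(I.filter fun i ↦ ∀ x ∈ P i, π x ∈ Y i x) := by
    intro π
    rw [← prod_const, prod_filter]
    refine prod_congr rfl fun i _ ↦ ?_
    split_ifs <;> norm_num
  simp only [hprod] at h
  set B := univ.filter fun π : Equiv.Perm V ↦ #(I.filter fun i ↦ ∀ x ∈ P i, π x ∈ Y i x) < K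
  -- Markov's inequality: every permutation in `B` has weight at least `(1 / 2) ^ K`.
  have h₁ : (#B : ℝ) * (1 / 2) ^ K ≤
      ∑ π : Equiv.Perm V, (1 / 2 : ℝ) ^ #(I.filter fun i ↦ ∀ x ∈ P i, π x ∈ Y i x) := by
    rw [← nsmul_eq_mul, ← sum_const]
    refine (sum_le_sum fun π hπ ↦ ?_).trans
      (sum_le_sum_of_subset_of_nonneg (subset_univ B) fun _ _ _ ↦ by positivity)
    exact pow_le_pow_of_le_one (by norm_num) (by norm_num) (mem_filter.1 hπ).2.le
  have h₂ : (#B : ℝ) = 2 ^ K * (#B * (1 / 2) ^ K) := by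
    rw [mul_left_comm, ← mul_pow]; norm_num
  rw [h₂, mul_assoc]
  exact mul_le_mul_of_nonneg_left (h₁.trans h) (by positivity)

end Perm

/-! ### Switchable vertices under a random permutation. -/

namespace Digraph

variable {V : Type*} [Fintype V] [DecidableEq V]

/-- A vertex together with its in- and out-neighbours. -/
noncomputable def closedNbrs (T : Digraph V) (v : V) : Finset V :=
  insert v (T.dirNbrs true v ∪ T.dirNbrs false v)

lemma mem_closedNbrs {T : Digraph V} {v w : V} :
    w ∈ T.closedNbrs v ↔ w = v ∨ ∃ o, T.DirAdj o v w := by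
  simp [closedNbrs, or_comm]

lemma mem_closedNbrs_comm {T : Digraph V} {v w : V} :
    w ∈ T.closedNbrs v ↔ v ∈ T.closedNbrs w := by
  simp only [mem_closedNbrs, Bool.exists_bool, dirAdj_false, dirAdj_true]
  tauto

lemma card_closedNbrs_le {T : Digraph V} {d : ℕ} (hd : ∀ o v, #(T.dirNbrs o v) ≤ d) (v : V) :
    #(T.closedNbrs v) ≤ 2 * d + 1 := by
  have h₁ := card_insert_le v (T.dirNbrs true v ∪ T.dirNbrs false v)
  have h₂ := card_union_le (T.dirNbrs true v) (T.dirNbrs false v)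
  have h₃ := hd true v
  have h₄ := hd false v
  unfold closedNbrs
  omega

/-- In a digraph of bounded degree there are many vertices with disjoint neighbourhoods. -/
lemma exists_pairwiseDisjoint_closedNbrs {T : Digraph V} {d : ℕ}
    (hd : ∀ o v, #(T.dirNbrs o v) ≤ d) (N : ℕ) (hN : N * (2 * d + 1) ^ 2 ≤ Fintype.card V) :
    ∃ I : Finset V, #I = N ∧ (I : Set V).PairwiseDisjoint T.closedNbrs := by
  induction N with
  | zero => exact ⟨∅, by simp, by simp⟩
  | succ N ih =>
    have hexp : (N + 1) * (2 * d + 1) ^ 2 = N * (2 * d + 1) ^ 2 + (2 * d + 1) ^ 2 := by ring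
    have hpos : 0 < (2 * d + 1) ^ 2 := by positivity
    obtain ⟨I, hI, hdisj⟩ := ih (by omega)
    -- Only vertices within distance two of `I` have a closed neighbourhood meeting an earlier one.
    have hcard : #((I.biUnion T.closedNbrs).biUnion T.closedNbrs) < #(univ : Finset V) := by
      have h₁ := card_biUnion_le_card_mul I T.closedNbrs (2 * d + 1) fun v _ ↦
        card_closedNbrs_le hd v
      have h₂ := card_biUnion_le_card_mul (I.biUnion T.closedNbrs) T.closedNbrs (2 * d + 1)
        fun v _ ↦ card_closedNbrs_le hd v
      have h₃ : #(I.biUnion T.closedNbrs) * (2 * d + 1) ≤ #I * (2 * d + 1) * (2 * d + 1) :=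
        Nat.mul_le_mul_right _ h₁
      have h₄ : #I * (2 * d + 1) * (2 * d + 1) = N * (2 * d + 1) ^ 2 := by rw [hI]; ring
      rw [card_univ]
      omega
    obtain ⟨j, -, hj⟩ := Finset.exists_mem_notMem_of_card_lt_card hcard
    have hdj : ∀ i ∈ I, Disjoint (T.closedNbrs j) (T.closedNbrs i) := by
      intro i hi
      rw [disjoint_left]
      intro x hxj hxi
      exact hj (mem_biUnion.2 ⟨x, mem_biUnion.2 ⟨i, hi, hxi⟩, mem_closedNbrs_comm.1 hxj⟩)
    have hjI : j ∉ I := fun h ↦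
      disjoint_left.1 (hdj j h) (mem_closedNbrs.2 (Or.inl rfl)) (mem_closedNbrs.2 (Or.inl rfl))
    refine ⟨insert j I, by rw [card_insert_of_notMem hjI, hI], ?_⟩
    rw [coe_insert]
    exact hdisj.insert fun i hi _ ↦ hdj i hi

/-- For most permutations, all sets of switchable vertices are large. -/
theorem card_filter_switchable_lt_le {T D : Digraph V} {d : ℕ} (hT : T.IsOrientedTree)
    (hd : ∀ o v, #(T.dirNbrs o v) ≤ d) {β : ℝ} (hβ : 0 ≤ β) (hβ1 : β ≤ 1) {N : ℕ}
    (hN : N * (2 * d + 1) ^ 2 ≤ Fintype.card V)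
    (hD : ∀ o v, β * Fintype.card V + (2 * d + 1) * N ≤ #(D.dirNbrs o v)) (K : ℕ) :
    (#(univ.filter fun φ : Equiv.Perm V ↦ ∃ o u w, #(switchable T D φ o u w) < K) : ℝ) ≤
      2 * Fintype.card V ^ 2 * (2 ^ K * (1 - β ^ (2 * d + 1) / 2) ^ N) *
        Fintype.card (Equiv.Perm V) := by
  classical
  obtain ⟨I, hI, hdisj⟩ := exists_pairwiseDisjoint_closedNbrs hd N hN
  have hone : ∀ o u w, (#(univ.filter fun φ : Equiv.Perm V ↦ #(switchable T D φ o u w) < K) : ℝ) ≤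
      2 ^ K * (1 - β ^ (2 * d + 1) / 2) ^ N * Fintype.card (Equiv.Perm V) := by
    intro o u w
    -- These targets make `i` switchable: its own image must be a neighbour of `u`, and those of its
    -- tree neighbours must be neighbours of `w` in the matching direction.
    let Y : V → V → Finset V := fun i x ↦ if x = i then D.dirNbrs o u else
      if T.Adj i x then D.dirNbrs true w else D.dirNbrs false w
    have h := Equiv.Perm.card_filter_lt_le hβ hβ1 T.closedNbrs Y I
      (fun i _ ↦ card_closedNbrs_le hd i) hdisj ?_ K
    · rw [hI] at h
      refine le_trans ?_ h
      norm_cast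
      refine card_le_card fun φ hφ ↦ ?_
      simp only [mem_filter, mem_univ, true_and] at hφ ⊢
      refine lt_of_le_of_lt (card_le_card fun i hi ↦ ?_) hφ
      rw [mem_filter] at hi
      simp only [switchable, mem_filter, mem_univ, true_and]
      constructor
      · simpa [Y] using hi.2 i (mem_closedNbrs.2 (Or.inl rfl))
      · intro o' a h
        have hai : a ≠ i := by
          rintro rfl
          exact hT.1 a (by cases o' <;> simpa using h)
        have h₁ := hi.2 a (mem_closedNbrs.2 (Or.inr ⟨o', h⟩))
        cases o'
        · rw [dirAdj_false] at h
          simpa [Y, hai, hT.2.1 a i h] using h₁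
        · rw [dirAdj_true] at h
          simpa [Y, hai, h] using h₁
    · intro i x
      rw [hI]
      push_cast
      simp only [Y]
      split_ifs <;> exact hD _ _
  have hsub : (univ.filter fun φ : Equiv.Perm V ↦ ∃ o u w, #(switchable T D φ o u w) < K) ⊆
      (univ : Finset (Bool × V × V)).biUnion fun z ↦
        univ.filter fun φ : Equiv.Perm V ↦ #(switchable T D φ z.1 z.2.1 z.2.2) < K := by
    intro φ hφ
    simp only [mem_filter, mem_univ, true_and, mem_biUnion, Prod.exists] at hφ ⊢
    exact hφ
  have h₁ := (card_le_card hsub).trans card_biUnion_le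
  have h₂ : (#(univ.filter fun φ : Equiv.Perm V ↦ ∃ o u w, #(switchable T D φ o u w) < K) : ℝ) ≤
      ∑ z : Bool × V × V,
        (#(univ.filter fun φ : Equiv.Perm V ↦ #(switchable T D φ z.1 z.2.1 z.2.2) < K) : ℝ) := by
    exact_mod_cast h₁
  refine h₂.trans ((sum_le_sum fun z _ ↦ hone z.1 z.2.1 z.2.2).trans (le_of_eq ?_))
  simp only [sum_const, card_univ, Fintype.card_prod, Fintype.card_bool, nsmul_eq_mul]
  push_cast
  ring

end Digraph

/-! ### The random digraph: relabelling and joinedness. -/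

namespace Digraph

open MeasureTheory ProbabilityTheory

variable {V : Type*}

/-- The edge set obtained by relabelling the vertices. -/
def relabel (π : Equiv.Perm V) : Set (V × V) ≃ Set (V × V) :=
  Equiv.Set.congr (Equiv.prodCongr π π)

lemma relabel_apply (π : Equiv.Perm V) (E : Set (V × V)) :
    relabel π E = (Equiv.prodCongr π π) '' E := rfl

lemma adj_ofEdgeSet_relabel (π : Equiv.Perm V) (E : Set (V × V)) {a b : V}
    (h : (ofEdgeSet E).Adj a b) : (ofEdgeSet (relabel π E)).Adj (π a) (π b) :=
  ⟨(a, b), h, rfl⟩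

instance (p : unitInterval) : IsProbabilityMeasure (binomialRandomEdges V p) :=
  inferInstanceAs (IsProbabilityMeasure (setBernoulli _ p))

/-- The mass of an edge set depends only on its size and on its being loopless, and relabelling
preserves both. -/
lemma binomialRandomEdges_real_relabel [Finite V] (p : unitInterval) (π : Equiv.Perm V)
    (E : Set (V × V)) :
    (binomialRandomEdges V p).real {relabel π E} = (binomialRandomEdges V p).real {E} := by
  have hu : (Equiv.prodCongr π π) '' {e : V × V | e.1 ≠ e.2} = {e : V × V | e.1 ≠ e.2} := by
    rw [Equiv.image_eq_preimage_symm]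
    ext ⟨x, y⟩
    simp
  have hsub : relabel π E ⊆ {e : V × V | e.1 ≠ e.2} ↔ E ⊆ {e : V × V | e.1 ≠ e.2} := by
    rw [relabel_apply]
    nth_rw 1 [← hu]
    exact Set.image_subset_image_iff (Equiv.prodCongr π π).injective
  unfold binomialRandomEdges
  by_cases hE : E ⊆ {e : V × V | e.1 ≠ e.2}
  · rw [setBernoulli_real_singleton p hE (Set.toFinite _),
      setBernoulli_real_singleton p (hsub.2 hE) (Set.toFinite _), relabel_apply,
      Set.ncard_image_of_injective _ (Equiv.prodCongr π π).injective]
    nth_rw 1 [← hu]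
    rw [← Set.image_sdiff (Equiv.prodCongr π π).injective,
      Set.ncard_image_of_injective _ (Equiv.prodCongr π π).injective]
  · rw [measureReal_def, measureReal_def, setBernoulli_singleton_of_not_subset p hE,
      setBernoulli_singleton_of_not_subset p (fun h ↦ hE (hsub.1 h))]

open Classical in
/-- If every edge set in `J` lies in `G` after most relabellings of the vertices, then the random
edge set lies in `G` almost as often as in `J`. -/
theorem mul_binomialRandomEdges_real_le [Fintype V] [DecidableEq V] (p : unitInterval)
    {J G : Set (Set (V × V))} {η : ℝ}
    (h : ∀ E ∈ J, η * Fintype.card (Equiv.Perm V) ≤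
      #(univ.filter fun π : Equiv.Perm V ↦ relabel π E ∈ G)) :
    η * (binomialRandomEdges V p).real J ≤ (binomialRandomEdges V p).real G := by
  set μ := binomialRandomEdges V p with hμ
  have hsum : ∀ A : Set (Set (V × V)), μ.real A = ∑ E, if E ∈ A then μ.real {E} else 0 := by
    intro A
    rw [← sum_filter, sum_measureReal_singleton]
    simp
  have hcard : (0 : ℝ) < Fintype.card (Equiv.Perm V) := by
    exact_mod_cast Fintype.card_pos
  -- Count pairs (permutation, edge set) in two ways: by invariance each permutation contributes the
  -- measure of `G`.
  have h₁ : Fintype.card (Equiv.Perm V) * μ.real G =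
      ∑ E, (#(univ.filter fun π : Equiv.Perm V ↦ relabel π E ∈ G) : ℝ) * μ.real {E} := by
    calc Fintype.card (Equiv.Perm V) * μ.real G
        = ∑ π : Equiv.Perm V, ∑ E, if relabel π E ∈ G then μ.real {E} else 0 := by
          rw [← nsmul_eq_mul, ← card_univ, ← sum_const]
          refine sum_congr rfl fun π _ ↦ ?_
          rw [hsum, ← Equiv.sum_comp (relabel π)]
          simp only [hμ, binomialRandomEdges_real_relabel]
      _ = _ := by
          rw [sum_comm]
          refine sum_congr rfl fun E _ ↦ ?_
          rw [← sum_filter, sum_const, nsmul_eq_mul]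
  have h₂ : Fintype.card (Equiv.Perm V) * (η * μ.real J) ≤
      Fintype.card (Equiv.Perm V) * μ.real G := by
    rw [h₁, hsum J, ← mul_assoc, mul_sum]
    refine sum_le_sum fun E _ ↦ ?_
    split_ifs with hE
    · exact mul_le_mul_of_nonneg_right (by linarith [h E hE]) measureReal_nonneg
    · rw [mul_zero]; exact mul_nonneg (Nat.cast_nonneg _) measureReal_nonneg
  exact le_of_mul_le_mul_left h₂ hcard

lemma binomialRandomEdges_real_forall_notMem [Countable V] (p : unitInterval) (F : Finset (V × V))
    (hF : ∀ e ∈ F, e.1 ≠ e.2) :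
    (binomialRandomEdges V p).real {E | ∀ e ∈ F, e ∉ E} = (1 - p : ℝ) ^ #F := by
  have hset : ((fun q : V × V → Prop ↦ {e | q e}) ⁻¹' {E : Set (V × V) | ∀ e ∈ F, e ∉ E}) =
      Set.pi (F : Set (V × V)) fun _ ↦ {False} := by
    ext q
    simp
  rw [measureReal_def, binomialRandomEdges, setBernoulli_apply', hset,
    Measure.infinitePi_pi _ (by simp)]
  rw [Finset.prod_congr rfl (g := fun _ ↦ ((unitInterval.toNNReal (unitInterval.symm p) : NNReal) :
    ENNReal)) fun e he ↦ by simp [hF e he]]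
  simp

/-- A random digraph is unlikely to have two large sets without an edge between them. -/
theorem binomialRandomEdges_real_not_joined_le [Fintype V] [DecidableEq V] (p : unitInterval)
    (k : ℕ) :
    (binomialRandomEdges V p).real {E | ¬ (ofEdgeSet E).Joined k} ≤
      4 ^ Fintype.card V * (1 - p : ℝ) ^ (k * (k - 1)) := by
  have hp0 : (0 : ℝ) ≤ 1 - p := by linarith [p.2.2]
  have hp1 : (1 - p : ℝ) ≤ 1 := by linarith [p.2.1]
  let I : Finset (Finset V × Finset V) := univ.filter fun z ↦ k ≤ #z.1 ∧ k ≤ #z.2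
  let F : Finset V × Finset V → Finset (V × V) := fun z ↦
    (z.1 ×ˢ z.2).filter fun e ↦ ¬ e.1 = e.2
  have hsub : {E : Set (V × V) | ¬ (ofEdgeSet E).Joined k} ⊆
      ⋃ z ∈ I, {E | ∀ e ∈ F z, e ∉ E} := by
    intro E hE
    simp only [Set.mem_ofPred_eq, Joined, not_forall] at hE
    obtain ⟨X, Y, hX, hY, h⟩ := hE
    push Not at h
    simp only [Set.mem_iUnion]
    refine ⟨(X, Y), by simp [I, hX, hY], ?_⟩
    rintro ⟨x, y⟩ he
    simp only [F, mem_filter, mem_product] at he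
    exact h x he.1.1 y he.1.2
  -- The two sets may overlap, so up to `#X` diagonal pairs are lost; hence `k * (k - 1)`.
  have hF : ∀ z ∈ I, k * (k - 1) ≤ #(F z) := by
    rintro ⟨X, Y⟩ hz
    simp only [I, mem_filter, mem_univ, true_and] at hz
    have h₁ := Finset.card_filter_add_card_filter_not (s := X ×ˢ Y) (fun e ↦ e.1 = e.2)
    have h₂ : #((X ×ˢ Y).filter fun e ↦ e.1 = e.2) ≤ #X := by
      refine card_le_card_of_injOn Prod.fst ?_ ?_
      · intro e he
        simp only [coe_filter, mem_product, Set.mem_ofPred_eq] at he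
        exact he.1.1
      · rintro ⟨x, y⟩ he ⟨x', y'⟩ he' (rfl : x = x')
        simp only [coe_filter, Set.mem_ofPred_eq] at he he'
        rw [← he.2, ← he'.2]
    rw [card_product] at h₁
    have h₃ : k * (k - 1) ≤ #X * (#Y - 1) := Nat.mul_le_mul hz.1 (by omega)
    have h₄ : #X * (#Y - 1) = #X * #Y - #X := by rw [Nat.mul_sub, mul_one]
    simp only [F]
    omega
  calc (binomialRandomEdges V p).real {E | ¬ (ofEdgeSet E).Joined k}
      ≤ (binomialRandomEdges V p).real (⋃ z ∈ I, {E | ∀ e ∈ F z, e ∉ E}) :=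
        measureReal_mono hsub (measure_ne_top _ _)
    _ ≤ ∑ z ∈ I, (binomialRandomEdges V p).real {E | ∀ e ∈ F z, e ∉ E} :=
        measureReal_biUnion_finset_le _ _
    _ ≤ ∑ z ∈ I, (1 - p : ℝ) ^ (k * (k - 1)) := by
        refine sum_le_sum fun z hz ↦ ?_
        rw [binomialRandomEdges_real_forall_notMem p (F z) fun e he ↦ (mem_filter.1 he).2]
        exact pow_le_pow_of_le_one hp0 hp1 (hF z hz)
    _ = #I * (1 - p : ℝ) ^ (k * (k - 1)) := by rw [sum_const, nsmul_eq_mul]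
    _ ≤ _ := by
        refine mul_le_mul_of_nonneg_right ?_ (pow_nonneg hp0 _)
        have h : #I ≤ 4 ^ Fintype.card V := by
          refine (card_le_univ I).trans (le_of_eq ?_)
          rw [Fintype.card_prod, Fintype.card_finset, ← mul_pow]; rfl
        exact_mod_cast h

/-- The quantitative form of the embedding theorem, before the choice of the parameters. -/
theorem one_sub_le_binomialRandomEdges_real_contained [Fintype V] [DecidableEq V]
    {T D : Digraph V} {d k N : ℕ} (hk : 1 ≤ k) (hT : T.IsOrientedTree)
    (hd : ∀ o v, #(T.dirNbrs o v) ≤ d) (hkn : (4 * d + 9) * k < Fintype.card V)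
    {β : ℝ} (hβ : 0 ≤ β) (hβ1 : β ≤ 1) (hN : N * (2 * d + 1) ^ 2 ≤ Fintype.card V)
    (hD : ∀ o v, β * Fintype.card V + (2 * d + 1) * N ≤ #(D.dirNbrs o v)) (p : unitInterval) :
    1 - 2 * Fintype.card V ^ 2 *
        (2 ^ ((4 * d + 3) * ((4 * d + 9) * k) + 2) * (1 - β ^ (2 * d + 1) / 2) ^ N) -
      4 ^ Fintype.card V * (1 - p : ℝ) ^ (k * (k - 1)) ≤
    (binomialRandomEdges V p).real {E | T.Contained (D ⊔ ofEdgeSet E)} := by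
  classical
  set K := (4 * d + 3) * ((4 * d + 9) * k) + 2 with hK
  set η : ℝ := 2 * Fintype.card V ^ 2 * (2 ^ K * (1 - β ^ (2 * d + 1) / 2) ^ N) with hη
  have hq1 : β ^ (2 * d + 1) ≤ 1 := pow_le_one₀ hβ hβ1
  have hη0 : 0 ≤ η := by
    have : 0 ≤ 1 - β ^ (2 * d + 1) / 2 := by linarith
    positivity
  have hbad := card_filter_switchable_lt_le hT hd hβ hβ1 hN hD K
  have hmain := mul_binomialRandomEdges_real_le p (η := 1 - η)
    (J := {E | (ofEdgeSet E).Joined k}) (G := {E | T.Contained (D ⊔ ofEdgeSet E)}) ?_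
  · have h₁ := binomialRandomEdges_real_not_joined_le (V := V) p k
    have h₂ : (binomialRandomEdges V p).real {E | ¬ (ofEdgeSet E).Joined k} =
        1 - (binomialRandomEdges V p).real {E | (ofEdgeSet E).Joined k} :=
      probReal_compl_eq_one_sub (Set.toFinite _).measurableSet
    have h₃ : (binomialRandomEdges V p).real {E | (ofEdgeSet E).Joined k} ≤ 1 :=
      measureReal_le_one
    have h₄ : η * (binomialRandomEdges V p).real {E | (ofEdgeSet E).Joined k} ≤ η * 1 :=
      mul_le_mul_of_nonneg_left h₃ hη0
    linarith
  · intro E hE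
    obtain ⟨r, S, ψ, hr, hS, hSc, hemb⟩ := Joined.exists_embedsOn hk hE hT hd hkn
    -- `ψ` depends on `E` alone, and `π * ψ` embeds the same part of the tree into the relabelled
    -- digraph. Since `π ↦ π * ψ` is a bijection, the count of good permutations carries over.
    have hsub : (univ.filter fun φ : Equiv.Perm V ↦
        ¬ ∃ o u w, #(switchable T D φ o u w) < K) ⊆
        (univ.filter fun π : Equiv.Perm V ↦
          relabel π E ∈ {E | T.Contained (D ⊔ ofEdgeSet E)}).image fun π ↦ π * ψ := by
      intro φ hφ
      simp only [mem_filter, mem_univ, true_and] at hφ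
      push Not at hφ
      refine mem_image.2 ⟨φ * ψ⁻¹, ?_, by simp⟩
      simp only [mem_filter, mem_univ, true_and, Set.mem_ofPred_eq]
      refine contained_of_switchable hT hd hr hS hSc (φ := φ) ?_ hφ
      intro a ha b hb hab
      simpa using adj_ofEdgeSet_relabel (φ * ψ⁻¹) E (hemb a ha b hb hab)
    have h₁ := (card_le_card hsub).trans card_image_le
    have h₂ := Finset.card_filter_add_card_filter_not (s := (univ : Finset (Equiv.Perm V)))
      (fun φ ↦ ∃ o u w, #(switchable T D φ o u w) < K)
    rw [card_univ] at h₂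
    have h₃ : (Fintype.card (Equiv.Perm V) : ℝ) ≤
        #(univ.filter fun φ : Equiv.Perm V ↦ ∃ o u w, #(switchable T D φ o u w) < K) +
        #(univ.filter fun π : Equiv.Perm V ↦
          relabel π E ∈ {E | T.Contained (D ⊔ ofEdgeSet E)}) := by
      exact_mod_cast (by omega)
    rw [sub_mul, one_mul]
    linarith

end Digraph

/-! ### Degree conditions, asymptotics and choice of the parameters. -/

namespace Digraph

lemma card_dirNbrs_le_of_maxTotalDegree_le {V : Type*} [Fintype V] {T : Digraph V} {d : ℕ}
    (h : T.maxTotalDegree ≤ d) (o : Bool) (v : V) : #(T.dirNbrs o v) ≤ d := by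
  have h₁ : T.inDegree v + T.outDegree v ≤ d :=
    (le_ciSup (f := fun v ↦ T.inDegree v + T.outDegree v) (Set.finite_range _).bddAbove v).trans h
  have h₂ : #(T.dirNbrs o v) = {w | T.DirAdj o v w}.ncard := by
    rw [← Set.ncard_coe_finset]; congr 1; ext; simp
  rw [h₂]
  cases o
  · simp only [dirAdj_false]; unfold inDegree at h₁; omega
  · simp only [dirAdj_true]; unfold outDegree at h₁; omega

lemma minSemidegree_le_card_dirNbrs {V : Type*} [Fintype V] (D : Digraph V) (o : Bool) (v : V) :
    D.minSemidegree ≤ #(D.dirNbrs o v) := by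
  have h₁ : D.minSemidegree ≤ min (D.outDegree v) (D.inDegree v) :=
    ciInf_le (f := fun v ↦ min (D.outDegree v) (D.inDegree v)) (OrderBot.bddBelow _) v
  have h₂ : #(D.dirNbrs o v) = {w | D.DirAdj o v w}.ncard := by
    rw [← Set.ncard_coe_finset]; congr 1; ext; simp
  rw [h₂]
  cases o
  · simp only [dirAdj_false]; exact h₁.trans (min_le_right _ _)
  · simp only [dirAdj_true]; exact h₁.trans (min_le_left _ _)

end Digraph

lemma two_pow_mul_one_sub_pow_le_exp {q : ℝ} (hq : q ≤ 1) (K N : ℕ) :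
    (2 : ℝ) ^ K * (1 - q / 2) ^ N ≤ Real.exp (K - q / 2 * N) := by
  have h₁ : (2 : ℝ) ^ K ≤ Real.exp K := by
    rw [← Real.exp_one_pow]
    exact pow_le_pow_left₀ (by norm_num) (by linarith [Real.add_one_le_exp (1 : ℝ)]) _
  have h₂ : (1 - q / 2) ^ N ≤ Real.exp (-(q / 2 * N)) := by
    have : Real.exp (-(q / 2 * N)) = Real.exp (-(q / 2)) ^ N := by
      rw [← Real.exp_nat_mul]; ring_nf
    rw [this]
    exact pow_le_pow_left₀ (by linarith) (Real.one_sub_le_exp_neg _) _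
  rw [show (K : ℝ) - q / 2 * N = K + -(q / 2 * N) by ring, Real.exp_add]
  exact mul_le_mul h₁ h₂ (pow_nonneg (by linarith) _) (Real.exp_pos _).le

lemma four_pow_mul_one_sub_pow_le_exp {p : ℝ} (hp : p ≤ 1) (n m : ℕ) :
    (4 : ℝ) ^ n * (1 - p) ^ m ≤ Real.exp (2 * n - p * m) := by
  have h₁ : (4 : ℝ) ^ n ≤ Real.exp (2 * n) := by
    have h : (4 : ℝ) ≤ Real.exp 2 := by
      have h₁ : (2 : ℝ) ≤ Real.exp 1 := by linarith [Real.add_one_le_exp (1 : ℝ)]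
      have h₂ : Real.exp 2 = Real.exp 1 * Real.exp 1 := by rw [← Real.exp_add]; norm_num
      nlinarith
    rw [mul_comm, Real.exp_nat_mul]
    exact pow_le_pow_left₀ (by norm_num) h _
  have h₂ : (1 - p) ^ m ≤ Real.exp (-(p * m)) := by
    have : Real.exp (-(p * m)) = Real.exp (-p) ^ m := by
      rw [← Real.exp_nat_mul]; ring_nf
    rw [this]
    exact pow_le_pow_left₀ (by linarith) (Real.one_sub_le_exp_neg _) _
  rw [show 2 * (n : ℝ) - p * m = 2 * n + -(p * m) by ring, Real.exp_add]
  exact mul_le_mul h₁ h₂ (pow_nonneg (by linarith) _) (Real.exp_pos _).le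

lemma tendsto_natCast_sq_mul_exp_neg {γ : ℝ} (hγ : 0 < γ) :
    Filter.Tendsto (fun n : ℕ ↦ (n : ℝ) ^ 2 * Real.exp (-γ * n)) Filter.atTop (nhds 0) := by
  have h := (Real.tendsto_pow_mul_exp_neg_atTop_nhds_zero 2).comp
    ((tendsto_natCast_atTop_atTop (R := ℝ)).const_mul_atTop hγ)
  have h' := h.const_mul ((γ ^ 2)⁻¹)
  rw [mul_zero] at h'
  refine h'.congr fun n ↦ ?_
  simp only [Function.comp_apply]
  rw [neg_mul]
  field_simp

theorem theorem1 (α : ℝ) (hα0 : 0 < α) (hα1 : α < 1) (Δ : ℕ) :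
    ∃ c : ℝ, 0 < c ∧ ∀ ε : ℝ, 0 < ε → ∃ N : ℕ, ∀ n : ℕ, N ≤ n →
      ∀ D : Digraph (Fin n), D.Loopless → α * n ≤ D.minSemidegree →
      ∀ T : Digraph (Fin n), T.IsOrientedTree → T.maxTotalDegree ≤ Δ →
        1 - ε ≤ (Digraph.binomialRandomEdges (Fin n) (Digraph.edgeProb c n)).real
          {E | T.Contained (D ⊔ Digraph.ofEdgeSet E)} := by
  set t : ℝ := 2 * Δ + 1 with ht
  have ht1 : 1 ≤ t := by rw [ht]; linarith [Nat.cast_nonneg (α := ℝ) Δ]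
  set q : ℝ := (α / 2) ^ (2 * Δ + 1) with hq
  have hq0 : 0 < q := by positivity
  have hq1 : q ≤ 1 := pow_le_one₀ (by positivity) (by linarith)
  -- With `N ≤ ν * n`, half of the semidegree covers the loss `(2 * Δ + 1) * N`.
  set ν : ℝ := α / (2 * t ^ 2) with hν
  have hν0 : 0 < ν := by positivity
  have hνt : ν * t ^ 2 = α / 2 := by rw [hν]; field_simp
  have hν1 : ν ≤ 1 := by
    have := le_mul_of_one_le_right hν0.le (one_le_pow₀ ht1 (n := 2))
    linarith
  set L : ℝ := 4 * Δ + 9 with hL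
  set M : ℝ := (4 * Δ + 3) * L with hM
  have hΔ0 : (0 : ℝ) ≤ Δ := Nat.cast_nonneg _
  have hL0 : 0 < L := by positivity
  have hM0 : 0 < M := by positivity
  have hLM : L ≤ M := by rw [hM]; nlinarith
  -- So small that `2 ^ K`, with `K` about `M * δ * n`, is beaten by the tail `exp (-q * ν * n /
  -- 2)`.
  set δ : ℝ := q * ν / (32 * M) with hδ
  have hδ0 : 0 < δ := by positivity
  have hMδ : M * δ = q * ν / 32 := by rw [hδ]; field_simp
  have hqν1 : q * ν ≤ 1 := mul_le_one₀ hq1 hν0.le hν1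
  -- Makes `c / n * (δ * n) ^ 2 / 2 = 4 * n`, which beats `4 ^ n ≤ exp (2 * n)`.
  set c : ℝ := 8 / δ ^ 2 with hc
  have hcδ : c * δ ^ 2 = 8 := by rw [hc]; field_simp
  have hc0 : 0 < c := by positivity
  clear_value t q ν L M δ c
  refine ⟨c, hc0, fun ε hε ↦ ?_⟩
  have hlim₁ : ∀ᶠ n : ℕ in Filter.atTop,
      2 * Real.exp (M + 3) * ((n : ℝ) ^ 2 * Real.exp (-(q * ν / 4) * n)) < ε / 2 := by
    have h := (tendsto_natCast_sq_mul_exp_neg (γ := q * ν / 4) (by positivity)).const_mul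
      (2 * Real.exp (M + 3))
    rw [mul_zero] at h
    exact h.eventually_lt_const (by positivity)
  have hlim₂ : ∀ᶠ n : ℕ in Filter.atTop, ((n : ℝ) ^ 2 * Real.exp (-2 * n)) < ε / 2 :=
    (tendsto_natCast_sq_mul_exp_neg (γ := 2) (by norm_num)).eventually_lt_const (by positivity)
  have hbig : ∀ x : ℝ, ∀ᶠ n : ℕ in Filter.atTop, x < (n : ℝ) := fun x ↦
    (tendsto_natCast_atTop_atTop (R := ℝ)).eventually_gt_atTop x
  obtain ⟨n₀, hn₀⟩ := Filter.eventually_atTop.1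
    (hlim₁.and (hlim₂.and ((hbig (2 * L)).and ((hbig c).and (hbig (2 / δ))))))
  refine ⟨n₀, fun n hn D _ hDdeg T hT hTdeg ↦ ?_⟩
  obtain ⟨h₁, h₂, hnL, hnc, hnδ⟩ := hn₀ n hn
  have hn1 : (1 : ℝ) ≤ n := by
    have : (9 : ℝ) ≤ L := by rw [hL]; linarith
    linarith
  set k : ℕ := ⌈δ * n⌉₊ with hk
  set N : ℕ := ⌊ν * n⌋₊ with hNdef
  have hδn : 2 < δ * n := by rw [div_lt_iff₀ hδ0] at hnδ; linarith
  have hk1 : δ * n ≤ k := Nat.le_ceil _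
  have hk2 : (k : ℝ) < δ * n + 1 := Nat.ceil_lt_add_one (by positivity)
  have hkpos : 1 ≤ k := by
    have : (0 : ℝ) < k := by linarith
    exact_mod_cast this
  have hN1 : (N : ℝ) ≤ ν * n := Nat.floor_le (by positivity)
  have hN2 : ν * n < N + 1 := Nat.lt_floor_add_one _
  have hkn : (4 * Δ + 9) * k < Fintype.card (Fin n) := by
    rw [Fintype.card_fin]
    have : L * k < n := by
      have h : L * δ ≤ 1 / 32 := (mul_le_mul_of_nonneg_right hLM hδ0.le).trans (by linarith)
      calc L * k ≤ L * (δ * n + 1) := mul_le_mul_of_nonneg_left hk2.le hL0.le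
        _ = L * δ * n + L := by ring
        _ ≤ 1 / 32 * n + L := by gcongr
        _ < n := by linarith
    rw [hL] at this
    exact_mod_cast this
  have hNn : N * (2 * Δ + 1) ^ 2 ≤ Fintype.card (Fin n) := by
    rw [Fintype.card_fin]
    have : (N : ℝ) * t ^ 2 ≤ n :=
      calc (N : ℝ) * t ^ 2 ≤ ν * n * t ^ 2 := mul_le_mul_of_nonneg_right hN1 (sq_nonneg t)
        _ = α / 2 * n := by rw [← hνt]; ring
        _ ≤ 1 * n := mul_le_mul_of_nonneg_right (by linarith) (by linarith)
        _ = n := one_mul _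
    rw [ht] at this
    exact_mod_cast this
  have hDn : ∀ o v, α / 2 * Fintype.card (Fin n) + (2 * Δ + 1) * N ≤ #(D.dirNbrs o v) := by
    intro o v
    rw [Fintype.card_fin]
    have h : (D.minSemidegree : ℝ) ≤ #(D.dirNbrs o v) := by
      exact_mod_cast D.minSemidegree_le_card_dirNbrs o v
    have h' : t * N ≤ α / 2 * n := by
      have : t * N ≤ t * (ν * n) := mul_le_mul_of_nonneg_left hN1 (by linarith)
      have h'' : t * ν ≤ α / 2 := by
        rw [← hνt, mul_comm]
        exact mul_le_mul_of_nonneg_left (le_self_pow₀ ht1 two_ne_zero) hν0.le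
      calc t * N ≤ t * ν * n := by linarith
        _ ≤ α / 2 * n := mul_le_mul_of_nonneg_right h'' (by linarith)
    rw [ht] at h'
    linarith
  -- The truncation is inactive because `n > c`.
  have hp : ((Digraph.edgeProb c n : unitInterval) : ℝ) = c / n := by
    rw [Digraph.edgeProb, Set.projIcc_of_mem zero_le_one
      ⟨by positivity, (div_le_one (by linarith)).2 hnc.le⟩]
  have hp1 : c / n ≤ 1 := (div_le_one (by linarith)).2 hnc.le
  have hmain := Digraph.one_sub_le_binomialRandomEdges_real_contained hkpos hT
    (Digraph.card_dirNbrs_le_of_maxTotalDegree_le hTdeg) hkn (β := α / 2) (by positivity)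
    (by linarith) hNn hDn (Digraph.edgeProb c n)
  rw [hp, Fintype.card_fin, ← hq] at hmain
  have herr₁ : 2 * (n : ℝ) ^ 2 *
      (2 ^ ((4 * Δ + 3) * ((4 * Δ + 9) * k) + 2) * (1 - q / 2) ^ N) ≤ ε / 2 := by
    refine le_trans ?_ h₁.le
    have h := two_pow_mul_one_sub_pow_le_exp hq1 ((4 * Δ + 3) * ((4 * Δ + 9) * k) + 2) N
    have hexp : (((4 * Δ + 3) * ((4 * Δ + 9) * k) + 2 : ℕ) : ℝ) - q / 2 * N ≤
        (M + 3) + -(q * ν / 4) * n := by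
      push_cast
      have e₁ : (4 * (Δ : ℝ) + 3) * ((4 * Δ + 9) * k) = M * k := by rw [hM, hL]; ring
      have e₂ : M * k ≤ M * (δ * n + 1) := mul_le_mul_of_nonneg_left hk2.le hM0.le
      have e₃ : M * (δ * n + 1) = q * ν / 32 * n + M := by rw [mul_add, ← mul_assoc, hMδ]; ring
      have e₄ : q / 2 * (ν * n) ≤ q / 2 * (N + 1) :=
        mul_le_mul_of_nonneg_left hN2.le (by positivity)
      have e₅ : 0 ≤ q * ν * n := by positivity
      rw [e₁]
      linarith
    have h' := (h.trans (Real.exp_le_exp.2 hexp)).trans_eq (Real.exp_add _ _)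
    calc _ ≤ 2 * (n : ℝ) ^ 2 * (Real.exp (M + 3) * Real.exp (-(q * ν / 4) * n)) :=
          mul_le_mul_of_nonneg_left h' (by positivity)
      _ = _ := by ring
  have herr₂ : (4 : ℝ) ^ n * (1 - c / n) ^ (k * (k - 1)) ≤ ε / 2 := by
    refine (four_pow_mul_one_sub_pow_le_exp hp1 n _).trans (le_trans ?_ h₂.le)
    have hexp : 2 * (n : ℝ) - c / n * ((k * (k - 1) : ℕ) : ℝ) ≤ -2 * n := by
      rw [Nat.cast_mul, Nat.cast_sub hkpos, Nat.cast_one]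
      have e₁ : δ * n * (δ * n / 2) ≤ k * ((k : ℝ) - 1) :=
        mul_le_mul hk1 (by linarith) (by positivity) (by positivity)
      have e₂ : c / n * (δ * n * (δ * n / 2)) ≤ c / n * (k * ((k : ℝ) - 1)) :=
        mul_le_mul_of_nonneg_left e₁ (by positivity)
      have e₃ : c / n * (δ * n * (δ * n / 2)) = 4 * n := by
        have : c / n * (δ * n * (δ * n / 2)) = c * δ ^ 2 / 2 * n := by field_simp
        rw [this, hcδ]; ring
      linarith
    -- The spare factor `n ^ 2 ≥ 1` only serves to reuse the same limit for both errors.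
    calc Real.exp _ ≤ 1 * Real.exp (-2 * n) := by rw [one_mul]; exact Real.exp_le_exp.2 hexp
      _ ≤ _ := mul_le_mul_of_nonneg_right (one_le_pow₀ hn1) (Real.exp_pos _).le
  linarith
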